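/- An overpartition of a nonnegative integer $n$ is a nonincreasing sequence of positive integers with sum $n$ in which the first occurrence of each distinct part may be overlined. For an odd integer $t\ge 3$, a $t$-Schur overpartition of $n$ is an overpartition of $n$ all of whose parts are congruent modulo $2t$ to elements of $I(t)=\{1,3,5,\dots,2t-1\}\setminus\{t\}$, and $\overline{S}_t(n)$ denotes the number of $t$-Schur overpartitions of $n$ (so $\overline{S}_t(0)=1$). Theorem. For all integers $n\ge 0$, $\alpha\ge 0$ and $\beta\ge 1$, \begin{align*} \overline{S}_3(3n) &\equiv \overline{S}_3(n) \pmod 4,\\ \overline{S}_3\big(2^{\alpha}(3n+j)\big) &\equiv \overline{S}_3(3n+j) \pmod 4 && \text{for each } j\in\{0,1,2\},\\ \overline{S}_3\big(2^{2\beta+j}(3n+2)\big) &\equiv \overline{S}_3\big(2^{j}(3n+2)\big) \pmod 8 && \text{for each } j\in\{0,1\}. \end{align*} -/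

import Mathlib

/-- The set `I(t) = {1, 3, 5, …, 2t - 1} \ {t}` of admissible residues modulo `2t`. -/
def schurResidues (t : ℕ) : Finset ℕ :=
  ((Finset.range (2 * t)).filter Odd).erase t

/-- The `t`-Schur overpartitions of `n`. An overpartition of `n` is a partition of `n` in which
the first occurrence of each distinct part may be overlined, that is, a pair consisting of a
partition `p` of `n` and a set of distinct parts of `p` (the sizes whose first occurrence is
overlined). It is a `t`-Schur overpartition if each part is congruent modulo `2t` to an element
of `I(t)`. -/
def schurOverpartitions (t n : ℕ) : Finset (Σ _ : n.Partition, Finset ℕ) :=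
  (Nat.Partition.restricted n (fun i => i % (2 * t) ∈ schurResidues t)).sigma
    fun p => p.parts.toFinset.powerset

/-- The number of `t`-Schur overpartitions of `n`. -/
def schurOverpartitionCount (t n : ℕ) : ℕ :=
  (schurOverpartitions t n).card

/-!
Let `φ(-q) = ∑ (-1)^a q^(a^2)`, summed over all integers `a`. By Gauss's identity
`φ(-q) = ∏ (1 - q^i) / (1 + q^i)`, the generating function of the numbers `S_t(n)` is
`φ(-q^2) φ(-q^t) / (φ(-q) φ(-q^(2t)))`. Since `φ^4 ≡ 1` modulo `8`, it is congruent to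
`φ(-q) φ(-q^t) · φ(-q^2) φ(-q^(2t)) · (φ(-q) φ(-q^(2t)))^2`, which modulo `8` reduces to
`φ(-q) φ(-q^t) + φ(-q^2) φ(-q^(2t)) - 1 + 4 E` where `E` only matters modulo `2`.

Modulo `4` only the representations of `n` as `a^2`, `2 a^2`, `t a^2`, `2 t a^2` remain, and
multiplying `n` by `2` or by `t` permutes these four shapes. For `t = 3` and modulo `8`, the
solutions of `a^2 + 3 b^2 = 4 n` with `a, b` even correspond to those of `a^2 + 3 b^2 = n`, while
those with `a, b` odd are paired off by a sixth root of unity of `ℤ[(1 + √-3) / 2]`, up to the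
fixed points `a = b` and `a = 3 b`. These fixed points compensate the sign changes of
`(-1)^a` in the single sums, so the coefficients of `φ(-q) φ(-q^3)` at `4 n` and `n` agree.
-/

open Finset PowerSeries Filter
open scoped PowerSeries.WithPiTopology Topology

section FiniteGauss

variable {R : Type*} [CommRing R]

/-- The `s`-th summand of the truncation error `gaussRemainder x n`. -/
def gaussRemainderTerm (x : R) (n s : ℕ) : R :=
  (-1) ^ (s + 1) * (∏ k ∈ range s, (1 + x ^ (k + 1))) *
    (∏ k ∈ Ico (s + 1) n, (1 - x ^ (k + 1))) * x ^ ((s + 1) * (n + 1))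

/-- Half the error, divisible by `x ^ (n + 1)`, in the truncation `finite_gauss` of Gauss's identity
`∏ (1 + x ^ k) * ∑ (-1) ^ k * x ^ (k ^ 2) = ∏ (1 - x ^ k)` (products over `k ≥ 1`, sum over
`k ∈ ℤ`). -/
def gaussRemainder (x : R) (n : ℕ) : R :=
  ∑ s ∈ range n, gaussRemainderTerm x n s

theorem gaussRemainderTerm_succ (x : R) {n s : ℕ} (hs : s < n) :
    gaussRemainderTerm x (n + 1) s =
      x ^ (s + 1) * (1 - x ^ (n + 1)) * gaussRemainderTerm x n s := by
  rw [gaussRemainderTerm, gaussRemainderTerm, prod_Ico_succ_top (by lia)]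
  ring

theorem sum_gaussRemainderTerm_mul (x : R) (n : ℕ) :
    ∑ s ∈ range n, (x ^ (s + 1) * (1 - x ^ (n + 1)) - (1 + x ^ (n + 1))) *
        gaussRemainderTerm x n s =
      (∏ k ∈ range n, (1 - x ^ (k + 1))) * x ^ (n + 1) -
        (-1) ^ n * (∏ k ∈ range n, (1 + x ^ (k + 1))) * x ^ ((n + 1) * (n + 1)) := by
  let boundary (m : ℕ) : R := (-1) ^ m * (∏ k ∈ range m, (1 + x ^ (k + 1))) *
    (∏ k ∈ Ico m n, (1 - x ^ (k + 1))) * x ^ ((m + 1) * (n + 1))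
  have telescope : ∀ s ∈ range n, (x ^ (s + 1) * (1 - x ^ (n + 1)) - (1 + x ^ (n + 1))) *
      gaussRemainderTerm x n s = boundary s - boundary (s + 1) := fun s hs => by
    simp only [boundary, gaussRemainderTerm]
    rw [prod_range_succ, prod_eq_prod_Ico_succ_bot (mem_range.mp hs)]
    ring
  rw [sum_congr rfl telescope, sum_range_sub']
  simp [boundary]

theorem gaussRemainder_succ (x : R) (n : ℕ) :
    gaussRemainder x (n + 1) = (1 + x ^ (n + 1)) * gaussRemainder x n +
      (∏ k ∈ range n, (1 - x ^ (k + 1))) * x ^ (n + 1) -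
      (-1) ^ n * (∏ k ∈ range (n + 1), (1 + x ^ (k + 1))) * x ^ ((n + 1) ^ 2) := by
  have lower_terms : ∑ s ∈ range n, gaussRemainderTerm x (n + 1) s = (1 + x ^ (n + 1)) *
      gaussRemainder x n + ∑ s ∈ range n, (x ^ (s + 1) * (1 - x ^ (n + 1)) - (1 + x ^ (n + 1))) *
        gaussRemainderTerm x n s := by
    rw [gaussRemainder, mul_sum, ← sum_add_distrib]
    refine sum_congr rfl fun s hs => ?_
    rw [gaussRemainderTerm_succ x (mem_range.mp hs)]
    ring
  rw [gaussRemainder, sum_range_succ, lower_terms, sum_gaussRemainderTerm_mul, gaussRemainderTerm,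
    Ico_self, prod_empty, prod_range_succ _ n]
  ring

theorem finite_gauss (x : R) (n : ℕ) :
    (∏ k ∈ range n, (1 + x ^ (k + 1))) *
        (1 + 2 * ∑ k ∈ range n, (-1) ^ (k + 1) * x ^ ((k + 1) ^ 2)) =
      (∏ k ∈ range n, (1 - x ^ (k + 1))) + 2 * gaussRemainder x n := by
  induction n with
  | zero => simp [gaussRemainder]
  | succ n ih =>
    rw [gaussRemainder_succ, prod_range_succ, prod_range_succ, sum_range_succ]
    linear_combination (1 + x ^ (n + 1)) * ih

theorem pow_succ_dvd_gaussRemainder (x : R) (n : ℕ) : x ^ (n + 1) ∣ gaussRemainder x n :=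
  dvd_sum fun s _ => (pow_dvd_pow x (Nat.le_mul_of_pos_left _ s.succ_pos)).mul_left _

end FiniteGauss

section Theta

/-- The positive integers `a` with `d * a ^ 2 = n` (for `d ≠ 0`). -/
def sqRoots (d n : ℕ) : Finset ℕ :=
  {a ∈ Icc 1 n | d * a ^ 2 = n}

theorem mem_sqRoots {d n a : ℕ} (hd : 0 < d) : a ∈ sqRoots d n ↔ 0 < a ∧ d * a ^ 2 = n := by
  rw [sqRoots, mem_filter, mem_Icc]
  refine ⟨fun h => ⟨h.1.1, h.2⟩, fun ⟨ha, h⟩ => ⟨⟨ha, ?_⟩, h⟩⟩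
  nlinarith

theorem sqRoots_mul_mul {c d : ℕ} (hc : 0 < c) (hd : 0 < d) (n : ℕ) :
    sqRoots (c * d) (c * n) = sqRoots d n := by
  ext a
  rw [mem_sqRoots (Nat.mul_pos hc hd), mem_sqRoots hd, mul_assoc, Nat.mul_right_inj hc.ne']

theorem sqRoots_sq_mul {c d n : ℕ} (hc : 0 < c) (hd : 0 < d)
    (h : ∀ a, d * a ^ 2 = c ^ 2 * n → c ∣ a) :
    sqRoots d (c ^ 2 * n) = (sqRoots d n).image (c * ·) := by
  ext a
  simp only [mem_image, mem_sqRoots hd]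
  constructor
  · rintro ⟨ha, h'⟩
    obtain ⟨b, rfl⟩ := h a h'
    exact ⟨b, ⟨Nat.pos_of_mul_pos_left ha, Nat.eq_of_mul_eq_mul_left (pow_pos hc 2)
      (by linear_combination h')⟩, rfl⟩
  · rintro ⟨b, ⟨hb, rfl⟩, rfl⟩
    exact ⟨Nat.mul_pos hc hb, by ring⟩

/-- The tail `∑_{a ≥ 1} (-1)^a X^(d a^2)` of the theta series `φ(-X^d)`. -/
noncomputable def thetaTail (d : ℕ) : ℤ⟦X⟧ :=
  PowerSeries.mk fun n => ∑ a ∈ sqRoots d n, (-1) ^ a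

/-- The theta series `φ(-X^d) = ∑_{a ∈ ℤ} (-1)^a X^(d a^2)`. -/
noncomputable def theta (d : ℕ) : ℤ⟦X⟧ :=
  1 + 2 * thetaTail d

theorem coeff_thetaTail (d n : ℕ) : coeff n (thetaTail d) = ∑ a ∈ sqRoots d n, (-1) ^ a :=
  coeff_mk _ _

theorem expand_thetaTail {c d : ℕ} (hc : c ≠ 0) (hd : 0 < d) :
    expand c hc (thetaTail d) = thetaTail (c * d) := by
  ext n
  by_cases h : c ∣ n
  · obtain ⟨m, rfl⟩ := h
    rw [coeff_expand_mul, coeff_thetaTail, coeff_thetaTail, sqRoots_mul_mul hc.pos hd]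
  · rw [coeff_expand_of_not_dvd _ _ _ h, coeff_thetaTail, sum_eq_zero]
    intro a ha
    have := ((mem_sqRoots (Nat.mul_pos hc.pos hd)).mp ha).2
    exact absurd ⟨d * a ^ 2, by rw [← this, mul_assoc]⟩ h

theorem expand_theta {c d : ℕ} (hc : c ≠ 0) (hd : 0 < d) :
    expand c hc (theta d) = theta (c * d) := by
  rw [theta, map_add, map_mul, expand_thetaTail hc hd, map_one, map_ofNat, theta]

theorem coeff_mul_thetaTail_mul {c d : ℕ} (hc : 0 < c) (hd : 0 < d) (n : ℕ) :
    coeff (c * n) (thetaTail (c * d)) = coeff n (thetaTail d) := by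
  rw [coeff_thetaTail, coeff_thetaTail, sqRoots_mul_mul hc hd]

theorem coeff_sum_neg_one_pow_mul_X_pow_sq {n m : ℕ} (h : n ≤ m) :
    coeff n (∑ k ∈ range m, (-1) ^ (k + 1) * (X : ℤ⟦X⟧) ^ ((k + 1) ^ 2)) =
      coeff n (thetaTail 1) := by
  have coeff_term (k : ℕ) : coeff n ((-1) ^ (k + 1) * (X : ℤ⟦X⟧) ^ ((k + 1) ^ 2)) =
      if (k + 1) ^ 2 = n then (-1) ^ (k + 1) else 0 := by
    rw [show (-1 : ℤ⟦X⟧) ^ (k + 1) = C ((-1) ^ (k + 1)) by simp, coeff_C_mul, coeff_X_pow]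
    simp [eq_comm]
  have roots : sqRoots 1 n = {a ∈ Ico (0 + 1) (m + 1) | a ^ 2 = n} := by
    ext a
    simp only [mem_sqRoots one_pos, mem_filter, mem_Ico, one_mul]
    constructor
    · exact fun ⟨ha, h'⟩ => ⟨⟨ha, by nlinarith⟩, h'⟩
    · exact fun ⟨ha, h'⟩ => ⟨ha.1, h'⟩
  rw [map_sum, coeff_thetaTail, roots, sum_filter, ← sum_Ico_add', range_eq_Ico]
  exact sum_congr rfl fun k _ => coeff_term k

end Theta

section Products

/-- The product `∏ (1 + ε X^i)` over the integers `i ≥ 1` satisfying `p`. -/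
noncomputable def eulerProd (ε : ℤ) (p : ℕ → Prop) [DecidablePred p] : ℤ⟦X⟧ :=
  ∏' i, if p (i + 1) then 1 + C ε * X ^ (i + 1) else 1

theorem hasProd_eulerProd (ε : ℤ) (p : ℕ → Prop) [DecidablePred p] :
    HasProd (fun i => if p (i + 1) then 1 + C ε * X ^ (i + 1) else 1) (eulerProd ε p) := by
  refine Multipliable.hasProd ?_
  have : (fun i => if p (i + 1) then 1 + C ε * X ^ (i + 1) else 1) =
      fun i => 1 + if p (i + 1) then C ε * (X : ℤ⟦X⟧) ^ (i + 1) else 0 := by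
    ext1 i
    split_ifs <;> simp only [add_zero]
  rw [this]
  apply WithPiTopology.multipliable_one_add_of_tendsto_order_atTop_nhds_top
  refine ENat.tendsto_nhds_top_iff_natCast_lt.mpr fun n => eventually_atTop.mpr ⟨n, fun m hm => ?_⟩
  refine lt_of_lt_of_le (b := ((m + 1 : ℕ) : ℕ∞)) (by norm_cast; lia) ?_
  refine nat_le_order _ _ fun i hi => ?_
  split_ifs
  · rw [coeff_C_mul, coeff_X_pow, if_neg (by lia), mul_zero]
  · exact map_zero _

theorem eulerProd_ne_zero (ε : ℤ) (p : ℕ → Prop) [DecidablePred p] : eulerProd ε p ≠ 0 := by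
  have h : constantCoeff (eulerProd ε p) = 1 := by
    rw [eulerProd, (hasProd_eulerProd ε p).multipliable.map_tprod _
      (WithPiTopology.continuous_constantCoeff ℤ)]
    refine (tprod_congr fun i => ?_).trans tprod_one
    split_ifs <;> simp
  exact fun h0 => by simp [h0] at h

theorem hasProd_one_add_X_pow (ε : ℤ) :
    HasProd (fun i => 1 + C ε * X ^ (i + 1)) (eulerProd ε fun _ => True) := by
  simpa using hasProd_eulerProd ε fun _ => True

theorem continuous_expand {c : ℕ} (hc : c ≠ 0) :
    Continuous (expand c hc : ℤ⟦X⟧ → ℤ⟦X⟧) := by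
  refine continuous_iff_continuousAt.mpr fun f => ?_
  rw [ContinuousAt, WithPiTopology.tendsto_iff_coeff_tendsto]
  intro n
  simp only [coeff_expand]
  split_ifs
  · exact (WithPiTopology.continuous_coeff ℤ _).continuousAt
  · exact tendsto_const_nhds

theorem eulerProd_dvd (ε : ℤ) {d : ℕ} (hd : d ≠ 0) :
    eulerProd ε (d ∣ ·) = expand d hd (eulerProd ε fun _ => True) := by
  have expanded := (hasProd_one_add_X_pow ε).map (expand d hd) (continuous_expand hd)
  have pos (k : ℕ) : 0 < d * (k + 1) := Nat.mul_pos hd.pos k.succ_pos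
  have inj : Function.Injective fun k : ℕ => d * (k + 1) - 1 := fun a b h => by
    have := Nat.eq_of_mul_eq_mul_left hd.pos (Nat.sub_one_cancel (pos a) (pos b) h)
    lia
  have sieved := (inj.hasProd_iff fun i hi => ?_).mpr (hasProd_eulerProd ε (d ∣ ·))
  · refine sieved.unique (expanded.congr_fun fun k => ?_)
    simp [Nat.sub_add_cancel (pos k), pow_mul, expand_X]
  · refine if_neg fun ⟨c, hc⟩ => hi ⟨c - 1, ?_⟩
    have : c ≠ 0 := by rintro rfl; simp at hc
    change d * (c - 1 + 1) - 1 = i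
    rw [Nat.sub_add_cancel (by lia), ← hc, Nat.add_sub_cancel]

theorem eulerProd_one_mul_theta_one :
    eulerProd 1 (fun _ => True) * theta 1 = eulerProd (-1) (fun _ => True) := by
  have tendsto_sum : Tendsto
      (fun n => ∑ k ∈ range n, (-1) ^ (k + 1) * (X : ℤ⟦X⟧) ^ ((k + 1) ^ 2))
      atTop (𝓝 (thetaTail 1)) := by
    rw [WithPiTopology.tendsto_iff_coeff_tendsto]
    exact fun n => tendsto_atTop_of_eventually_const (i₀ := n) fun _ =>
      coeff_sum_neg_one_pow_mul_X_pow_sq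
  have tendsto_remainder : Tendsto (gaussRemainder (X : ℤ⟦X⟧)) atTop (𝓝 0) := by
    rw [WithPiTopology.tendsto_iff_coeff_tendsto]
    refine fun n => tendsto_atTop_of_eventually_const (i₀ := n) fun m hm => ?_
    exact X_pow_dvd_iff.mp (pow_succ_dvd_gaussRemainder X m) n (by lia)
  have lhs := (hasProd_one_add_X_pow 1).tendsto_prod_nat.mul
    ((tendsto_sum.const_mul 2).const_add 1)
  have rhs := (hasProd_one_add_X_pow (-1)).tendsto_prod_nat.add (tendsto_remainder.const_mul 2)
  rw [mul_zero, add_zero] at rhs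
  refine tendsto_nhds_unique lhs (rhs.congr fun n => ?_)
  simpa [sub_eq_add_neg] using (finite_gauss (X : ℤ⟦X⟧) n).symm

theorem eulerProd_one_mul_theta {d : ℕ} (hd : 0 < d) :
    eulerProd 1 (d ∣ ·) * theta d = eulerProd (-1) (d ∣ ·) := by
  have h := congrArg (expand d hd.ne') eulerProd_one_mul_theta_one
  rwa [map_mul, expand_theta hd.ne' one_pos, mul_one, ← eulerProd_dvd, ← eulerProd_dvd] at h

theorem eulerProd_not_dvd_mul (ε : ℤ) {a b : ℕ} (hab : a.Coprime b) :
    eulerProd ε (fun i => ¬ a ∣ i ∧ ¬ b ∣ i) * (eulerProd ε (a ∣ ·) * eulerProd ε (b ∣ ·)) =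
      eulerProd ε (1 ∣ ·) * eulerProd ε (a * b ∣ ·) := by
  refine ((hasProd_eulerProd ε _).mul ((hasProd_eulerProd ε _).mul (hasProd_eulerProd ε _))).unique
    (((hasProd_eulerProd ε _).mul (hasProd_eulerProd ε _)).congr_fun fun i => ?_)
  have dvd_iff : a * b ∣ i + 1 ↔ a ∣ i + 1 ∧ b ∣ i + 1 :=
    ⟨fun h => ⟨dvd_of_mul_right_dvd h, dvd_of_mul_left_dvd h⟩, fun h =>
      hab.mul_dvd_of_dvd_of_dvd h.1 h.2⟩
  by_cases ha : a ∣ i + 1 <;> by_cases hb : b ∣ i + 1 <;> simp [dvd_iff, ha, hb]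

theorem one_add_two_mul_geom_series_mul_one_sub (i : ℕ) :
    (1 + ∑' j, 2 * (X : ℤ⟦X⟧) ^ ((i + 1) * (j + 1))) * (1 - X ^ (i + 1)) = 1 + X ^ (i + 1) := by
  have hX : constantCoeff ((X : ℤ⟦X⟧) ^ (i + 1)) = 0 := by simp
  have summable := WithPiTopology.summable_pow_of_constantCoeff_eq_zero hX
  have factor : ∑' j, 2 * (X : ℤ⟦X⟧) ^ ((i + 1) * (j + 1)) =
      2 * X ^ (i + 1) * ∑' j, ((X : ℤ⟦X⟧) ^ (i + 1)) ^ j := by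
    rw [← summable.tsum_mul_left]
    refine tsum_congr fun j => ?_
    ring
  rw [factor]
  linear_combination 2 * X ^ (i + 1) *
    WithPiTopology.tsum_pow_mul_one_sub_of_constantCoeff_eq_zero hX

theorem mk_card_overpartitions_mul_eulerProd (p : ℕ → Prop) [DecidablePred p] :
    (PowerSeries.mk fun n => (#((Nat.Partition.restricted n p).sigma
      fun q => q.parts.toFinset.powerset) : ℤ)) * eulerProd (-1) p = eulerProd 1 p := by
  have genFun : (PowerSeries.mk fun n => (#((Nat.Partition.restricted n p).sigma
      fun q => q.parts.toFinset.powerset) : ℤ)) =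
      Nat.Partition.genFun fun i _ => if p i then (2 : ℤ) else 0 := by
    ext n
    rw [Nat.Partition.coeff_genFun, coeff_mk, card_sigma, Nat.Partition.restricted, sum_filter]
    push_cast
    refine sum_congr rfl fun q _ => ?_
    rw [Finsupp.prod, prod_ite_zero]
    simp [card_powerset]
  rw [genFun]
  refine ((Nat.Partition.hasProd_genFun _).mul (hasProd_eulerProd (-1) p)).unique
    ((hasProd_eulerProd 1 p).congr_fun fun i => ?_)
  split_ifs
  · have := one_add_two_mul_geom_series_mul_one_sub i
    simpa [sub_eq_add_neg, smul_eq_C_mul] using this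
  · simp [smul_eq_C_mul]

end Products

/-- The generating function of the `t`-Schur overpartition numbers. -/
noncomputable def schurGenFun (t : ℕ) : ℤ⟦X⟧ :=
  PowerSeries.mk fun n => (schurOverpartitionCount t n : ℤ)

theorem mod_mem_schurResidues_iff {t : ℕ} (ht : Odd t) (i : ℕ) :
    i % (2 * t) ∈ schurResidues t ↔ ¬ 2 ∣ i ∧ ¬ t ∣ i := by
  have lt : i % (2 * t) < 2 * t := Nat.mod_lt _ (Nat.mul_pos two_pos ht.pos)
  rw [← Nat.dvd_mod_iff (dvd_mul_right 2 t), ← Nat.dvd_mod_iff (dvd_mul_left t 2)]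
  generalize i % (2 * t) = r at lt
  have dvd_iff (hr : Odd r) : t ∣ r ↔ r = t := by
    refine ⟨fun ⟨c, hc⟩ => ?_, fun h => h ▸ dvd_rfl⟩
    obtain ⟨hc', rfl | rfl⟩ : Odd c ∧ (c = 0 ∨ c = 1) := by
      have : c < 2 := by nlinarith
      exact ⟨Nat.Odd.of_mul_right (hc ▸ hr), by lia⟩
    · simp at hc'
    · rw [hc, mul_one]
  rw [schurResidues, mem_erase, mem_filter, mem_range, ← even_iff_two_dvd, Nat.not_even_iff_odd]
  exact ⟨fun h => ⟨h.2.2, (dvd_iff h.2.2).not.mpr h.1⟩, fun h =>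
    ⟨(dvd_iff h.1).not.mp h.2, lt, h.1⟩⟩

theorem schurGenFun_mul_theta {t : ℕ} (ht : Odd t) :
    schurGenFun t * (theta 1 * theta (2 * t)) = theta 2 * theta t := by
  have genFun : schurGenFun t * eulerProd (-1) (fun i => ¬ 2 ∣ i ∧ ¬ t ∣ i) =
      eulerProd 1 (fun i => ¬ 2 ∣ i ∧ ¬ t ∣ i) := by
    rw [← mk_card_overpartitions_mul_eulerProd]
    simp only [schurGenFun, schurOverpartitionCount, schurOverpartitions,
      mod_mem_schurResidues_iff ht]
  have h2t : Nat.Coprime 2 t := Nat.coprime_two_left.mpr ht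
  have plus := eulerProd_not_dvd_mul 1 h2t
  have minus := eulerProd_not_dvd_mul (-1) h2t
  simp only [← eulerProd_one_mul_theta one_pos, ← eulerProd_one_mul_theta two_pos,
    ← eulerProd_one_mul_theta ht.pos, ← eulerProd_one_mul_theta (Nat.mul_pos two_pos ht.pos)]
    at minus
  apply mul_left_cancel₀ (mul_ne_zero (eulerProd_ne_zero 1 (1 ∣ ·))
    (eulerProd_ne_zero 1 (2 * t ∣ ·)))
  linear_combination (-schurGenFun t) * minus + eulerProd 1 (2 ∣ ·) * eulerProd 1 (t ∣ ·) *
    theta 2 * theta t * genFun + theta 2 * theta t * plus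

section Congruences

theorem dvd_pow_sub_expand {p : ℕ} [Fact p.Prime] (hp : p ≠ 0) (f : ℤ⟦X⟧) :
    C (p : ℤ) ∣ f ^ p - expand p hp f := by
  have frobenius_map : map (Int.castRingHom (ZMod p)) (f ^ p - expand p hp f) = 0 := by
    rw [map_sub, map_pow, map_expand, sub_eq_zero]
    have h := MvPowerSeries.map_frobenius_expand p hp (f := map (Int.castRingHom (ZMod p)) f)
    rw [ZMod.frobenius_zmod, MvPowerSeries.map_id] at h
    exact h.symm
  have dvd_coeff (n : ℕ) : (p : ℤ) ∣ coeff n (f ^ p - expand p hp f) := by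
    rw [← ZMod.intCast_zmod_eq_zero_iff_dvd, ← eq_intCast (Int.castRingHom (ZMod p)),
      ← coeff_map, frobenius_map, map_zero]
  choose g hg using dvd_coeff
  exact ⟨PowerSeries.mk g, ext fun n => by rw [hg, coeff_C_mul, coeff_mk]⟩

theorem coeff_modEq {m : ℤ} {f g : ℤ⟦X⟧} (h : C m ∣ f - g) (n : ℕ) :
    coeff n f ≡ coeff n g [ZMOD m] := by
  obtain ⟨q, hq⟩ := h
  refine (Int.modEq_iff_dvd.mpr ⟨coeff n q, ?_⟩).symm
  rw [← map_sub, hq, coeff_C_mul]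

theorem exists_thetaTail_sq {d : ℕ} (hd : 0 < d) :
    ∃ q, thetaTail d ^ 2 = thetaTail (2 * d) + 2 * q := by
  obtain ⟨q, hq⟩ := dvd_pow_sub_expand two_ne_zero (thetaTail d)
  rw [expand_thetaTail two_ne_zero hd, Nat.cast_two, map_ofNat] at hq
  exact ⟨q, by linear_combination hq⟩

theorem exists_theta_sq {d : ℕ} (hd : 0 < d) :
    ∃ q, theta d ^ 2 = 1 + 4 * (thetaTail d + thetaTail (2 * d)) + 8 * q := by
  obtain ⟨q, hq⟩ := exists_thetaTail_sq hd
  exact ⟨q, by rw [theta]; linear_combination 4 * hq⟩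

theorem exists_theta_pow_four (d : ℕ) : ∃ q, theta d ^ 4 = 1 + 8 * q :=
  ⟨thetaTail d * (1 + thetaTail d) * (1 + 2 * thetaTail d + 2 * thetaTail d ^ 2), by
    rw [theta]; ring⟩

theorem exists_schurGenFun_eq_theta {t : ℕ} (ht : Odd t) :
    ∃ q, schurGenFun t =
      theta 1 * theta t * (theta 2 * theta (2 * t)) * (theta 1 ^ 2 * theta (2 * t) ^ 2) +
        8 * q := by
  obtain ⟨x, hx⟩ := exists_theta_pow_four 1
  obtain ⟨y, hy⟩ := exists_theta_pow_four (2 * t)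
  refine ⟨-schurGenFun t * (x * theta (2 * t) ^ 4 + y), ?_⟩
  linear_combination (theta 1 * theta (2 * t)) ^ 3 * schurGenFun_mul_theta ht -
    schurGenFun t * (theta (2 * t) ^ 4 * hx + hy)

/-- The series `E` with
`∑ S_t(n) X^n ≡ φ(-X) φ(-X^t) + φ(-X^2) φ(-X^(2t)) - 1 + 4 E` modulo `8`. -/
noncomputable def schurCorrection (t : ℕ) : ℤ⟦X⟧ :=
  thetaTail 1 + thetaTail 2 + thetaTail (2 * t) + thetaTail (4 * t) +
    (thetaTail 1 + thetaTail t) * (thetaTail 2 + thetaTail (2 * t))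

theorem exists_schurGenFun_eq {t : ℕ} (ht : Odd t) :
    ∃ q, schurGenFun t = theta 1 * theta t + theta 2 * theta (2 * t) - 1 +
      4 * schurCorrection t + 8 * q := by
  obtain ⟨q, hq⟩ := exists_schurGenFun_eq_theta ht
  obtain ⟨x, hx⟩ := exists_theta_sq one_pos
  obtain ⟨y, hy⟩ := exists_theta_sq (Nat.mul_pos two_pos ht.pos)
  rw [mul_one] at hx
  rw [← mul_assoc, show 2 * 2 * t = 4 * t from rfl] at hy
  let a := thetaTail 1 + thetaTail t
  let b := thetaTail 2 + thetaTail (2 * t)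
  let r := thetaTail 1 + thetaTail 2 + (thetaTail (2 * t) + thetaTail (4 * t))
  obtain ⟨z, hz⟩ : ∃ z, theta 1 ^ 2 * theta (2 * t) ^ 2 = 1 + 4 * r + 8 * z :=
    ⟨2 * (thetaTail 1 + thetaTail 2) * (thetaTail (2 * t) + thetaTail (4 * t)) +
      x * theta (2 * t) ^ 2 + y * (1 + 4 * (thetaTail 1 + thetaTail 2)), by
      linear_combination theta (2 * t) ^ 2 * hx + (1 + 4 * (thetaTail 1 + thetaTail 2)) * hy⟩
  obtain ⟨u, hu⟩ : ∃ u, theta 1 * theta t = 1 + 2 * (a + 2 * u) :=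
    ⟨thetaTail 1 * thetaTail t, by rw [theta, theta]; ring⟩
  obtain ⟨v, hv⟩ : ∃ v, theta 2 * theta (2 * t) = 1 + 2 * (b + 2 * v) :=
    ⟨thetaTail 2 * thetaTail (2 * t), by rw [theta, theta]; ring⟩
  refine ⟨q + (a * v + u * b + 2 * u * v) +
    r * (a + 2 * u + b + 2 * v + 2 * (a + 2 * u) * (b + 2 * v)) +
    z * (1 + 2 * (a + 2 * u)) * (1 + 2 * (b + 2 * v)), ?_⟩
  rw [hq, hz, hu, hv, schurCorrection]
  ring

theorem coeff_schurGenFun (t n : ℕ) :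
    coeff n (schurGenFun t) = schurOverpartitionCount t n :=
  coeff_mk _ _

end Congruences

section SquareRoots

theorem coeff_thetaTail_modEq (d n : ℕ) : coeff n (thetaTail d) ≡ #(sqRoots d n) [ZMOD 2] := by
  rw [coeff_thetaTail, card_eq_sum_ones, Nat.cast_sum]
  refine Int.ModEq.sum fun a _ => ?_
  rcases neg_one_pow_eq_or ℤ a with h | h <;> rw [h] <;> decide

theorem card_sqRoots_sq_mul {c d n : ℕ} (hc : 0 < c) (hd : 0 < d)
    (h : ∀ a, d * a ^ 2 = c ^ 2 * n → c ∣ a) : #(sqRoots d (c ^ 2 * n)) = #(sqRoots d n) := by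
  rw [sqRoots_sq_mul hc hd h, card_image_of_injective _ (mul_right_injective₀ hc.ne')]

theorem card_sqRoots_mul {p d : ℕ} (hp : Squarefree p) (hd : 0 < d) (hpd : p.Coprime d) (n : ℕ) :
    #(sqRoots d (p * n)) = #(sqRoots (p * d) n) := by
  have pos : 0 < p := hp.ne_zero.pos
  rw [← sqRoots_mul_mul pos hd, ← mul_assoc, ← sq]
  refine card_sqRoots_sq_mul pos (Nat.mul_pos pos hd) fun a ha => ?_
  have : d * a ^ 2 = p * n := Nat.eq_of_mul_eq_mul_left pos (by linear_combination ha)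
  exact (hp.dvd_pow_iff_dvd two_ne_zero).mp (hpd.dvd_of_dvd_mul_left ⟨n, this⟩)

theorem coeff_mul_thetaTail_add {p d : ℕ} (hp : Squarefree p) (hd : 0 < d) (hpd : p.Coprime d)
    (n : ℕ) : coeff (p * n) (thetaTail d + thetaTail (p * d)) ≡
      coeff n (thetaTail d + thetaTail (p * d)) [ZMOD 2] := by
  rw [map_add, map_add, coeff_mul_thetaTail_mul hp.ne_zero.pos hd, add_comm]
  refine Int.ModEq.add_left _ ((coeff_thetaTail_modEq _ _).trans ?_)
  rw [card_sqRoots_mul hp hd hpd]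
  exact (coeff_thetaTail_modEq _ _).symm

theorem coeff_four_mul_thetaTail_modEq {d n : ℕ} (hd : 0 < d)
    (h : ∀ a, d * a ^ 2 = 4 * n → 2 ∣ a) :
    coeff (4 * n) (thetaTail d) ≡ coeff n (thetaTail d) [ZMOD 2] := by
  have card_eq : #(sqRoots d (4 * n)) = #(sqRoots d n) := card_sqRoots_sq_mul two_pos hd h
  refine (coeff_thetaTail_modEq _ _).trans ?_
  rw [card_eq]
  exact (coeff_thetaTail_modEq _ _).symm

theorem two_dvd_of_mul_sq_eq_four_mul {d n : ℕ} (hd : ¬ 4 ∣ d) (a : ℕ) (h : d * a ^ 2 = 4 * n) :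
    2 ∣ a := by
  by_contra ha
  have coprime : Nat.Coprime 4 (a ^ 2) :=
    Nat.Coprime.pow 2 2 (Nat.coprime_two_left.mpr (Nat.odd_iff.mpr (by lia)))
  exact hd (coprime.dvd_of_dvd_mul_right ⟨n, h⟩)

theorem coeff_four_mul_thetaTail {d : ℕ} (hd : ¬ 4 ∣ d) (n : ℕ) :
    coeff (4 * n) (thetaTail d) = coeff n (thetaTail d) + 2 * #{a ∈ sqRoots d n | Odd a} := by
  have pos : 0 < d := Nat.pos_of_ne_zero fun h => hd (h ▸ dvd_zero 4)
  have halve : sqRoots d (4 * n) = (sqRoots d n).image (2 * ·) :=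
    sqRoots_sq_mul two_pos pos (two_dvd_of_mul_sq_eq_four_mul hd)
  rw [coeff_thetaTail, coeff_thetaTail, halve,
    sum_image (mul_right_injective₀ two_ne_zero).injOn, card_filter]
  push_cast
  rw [mul_sum, ← sum_add_distrib]
  refine sum_congr rfl fun a _ => ?_
  rw [pow_mul, neg_one_sq, one_pow]
  split_ifs with ha
  · rw [ha.neg_one_pow]; norm_num
  · rw [(Nat.not_odd_iff_even.mp ha).neg_one_pow]; norm_num

end SquareRoots

section ModFour

theorem schurOverpartitionCount_modEq_four {t : ℕ} (ht : Odd t) (n : ℕ) :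
    (schurOverpartitionCount t n : ℤ) ≡ coeff n (1 : ℤ⟦X⟧) +
      2 * coeff n (thetaTail 1 + thetaTail 2 + thetaTail t + thetaTail (2 * t)) [ZMOD 4] := by
  obtain ⟨q, hq⟩ := exists_schurGenFun_eq ht
  have h : C 4 ∣ schurGenFun t -
      (1 + C 2 * (thetaTail 1 + thetaTail 2 + thetaTail t + thetaTail (2 * t))) := by
    refine ⟨thetaTail 1 * thetaTail t + thetaTail 2 * thetaTail (2 * t) + schurCorrection t +
      2 * q, ?_⟩
    simp only [hq, theta, map_ofNat]
    ring
  rw [← coeff_schurGenFun, ← coeff_C_mul, ← map_add]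
  exact coeff_modEq h n

theorem coeff_mul_one {p : ℕ} (hp : p ≠ 0) (n : ℕ) :
    coeff (p * n) (1 : ℤ⟦X⟧) = coeff n (1 : ℤ⟦X⟧) := by
  simp [coeff_one, hp]

theorem schurOverpartitionCount_mul_modEq_four {p t n : ℕ} (ht : Odd t) (hp : p ≠ 0)
    (h : coeff (p * n) (thetaTail 1 + thetaTail 2 + thetaTail t + thetaTail (2 * t)) ≡
      coeff n (thetaTail 1 + thetaTail 2 + thetaTail t + thetaTail (2 * t)) [ZMOD 2]) :
    schurOverpartitionCount t (p * n) ≡ schurOverpartitionCount t n [MOD 4] := by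
  refine Int.natCast_modEq_iff.mp ((schurOverpartitionCount_modEq_four ht _).trans
    (Int.ModEq.trans ?_ (schurOverpartitionCount_modEq_four ht n).symm))
  rw [coeff_mul_one hp]
  exact (h.mul_left' (c := 2)).add_left _

theorem schurOverpartitionCount_two_mul {t : ℕ} (ht : Odd t) (n : ℕ) :
    schurOverpartitionCount t (2 * n) ≡ schurOverpartitionCount t n [MOD 4] := by
  refine schurOverpartitionCount_mul_modEq_four ht two_ne_zero ?_
  rw [add_assoc, map_add _ _ (thetaTail t + _), map_add _ _ (thetaTail t + _)]
  exact (coeff_mul_thetaTail_add Nat.prime_two.squarefree one_pos (Nat.coprime_one_right 2) n).add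
    (coeff_mul_thetaTail_add Nat.prime_two.squarefree ht.pos (Nat.coprime_two_left.mpr ht) n)

theorem schurOverpartitionCount_self_mul {t : ℕ} (ht : Odd t) (hsf : Squarefree t) (n : ℕ) :
    schurOverpartitionCount t (t * n) ≡ schurOverpartitionCount t n [MOD 4] := by
  refine schurOverpartitionCount_mul_modEq_four ht ht.pos.ne' ?_
  have h₁ := coeff_mul_thetaTail_add hsf one_pos (Nat.coprime_one_right t) n
  have h₂ := coeff_mul_thetaTail_add hsf two_pos (Nat.coprime_two_right.mpr ht) n
  rw [mul_one] at h₁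
  rw [mul_comm t 2] at h₂
  rw [add_right_comm (thetaTail 1), add_assoc, map_add, map_add]
  exact h₁.add h₂

theorem schurOverpartitionCount_two_pow_mul {t : ℕ} (ht : Odd t) (k n : ℕ) :
    schurOverpartitionCount t (2 ^ k * n) ≡ schurOverpartitionCount t n [MOD 4] := by
  induction k with
  | zero => rw [pow_zero, one_mul]
  | succ k ih =>
    rw [pow_succ', mul_assoc]
    exact (schurOverpartitionCount_two_mul ht _).trans ih

end ModFour

section SquarePairs

/-- The pairs of positive integers `(a, b)` with `i * a ^ 2 + j * b ^ 2 = n` (for `i, j ≠ 0`). -/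
def squarePairs (i j n : ℕ) : Finset (ℕ × ℕ) :=
  {p ∈ Icc 1 n ×ˢ Icc 1 n | i * p.1 ^ 2 + j * p.2 ^ 2 = n}

theorem mem_squarePairs {i j n : ℕ} (hi : 0 < i) (hj : 0 < j) {p : ℕ × ℕ} :
    p ∈ squarePairs i j n ↔ 0 < p.1 ∧ 0 < p.2 ∧ i * p.1 ^ 2 + j * p.2 ^ 2 = n := by
  rw [squarePairs, mem_filter, mem_product, mem_Icc, mem_Icc]
  refine ⟨fun h => ⟨h.1.1.1, h.1.2.1, h.2⟩, fun ⟨ha, hb, h⟩ => ⟨⟨⟨ha, ?_⟩, ⟨hb, ?_⟩⟩, h⟩⟩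
  · nlinarith [Nat.le_mul_of_pos_left (p.1 ^ 2) hi]
  · nlinarith [Nat.le_mul_of_pos_left (p.2 ^ 2) hj]

theorem coeff_thetaTail_mul_thetaTail_modEq {i j : ℕ} (hi : 0 < i) (hj : 0 < j) (n : ℕ) :
    coeff n (thetaTail i * thetaTail j) ≡ #(squarePairs i j n) [ZMOD 2] := by
  have fiber (x : ℕ × ℕ) (hx : x ∈ antidiagonal n) :
      {p ∈ squarePairs i j n | (i * p.1 ^ 2, j * p.2 ^ 2) = x} =
        sqRoots i x.1 ×ˢ sqRoots j x.2 := by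
    ext p
    rw [mem_filter, mem_squarePairs hi hj, mem_product, mem_sqRoots hi, mem_sqRoots hj,
      Prod.ext_iff]
    rw [HasAntidiagonal.mem_antidiagonal] at hx
    lia
  have maps : Set.MapsTo (fun p : ℕ × ℕ => (i * p.1 ^ 2, j * p.2 ^ 2)) (squarePairs i j n)
      (antidiagonal n) := fun p hp =>
    mem_coe.mpr (HasAntidiagonal.mem_antidiagonal.mpr ((mem_squarePairs hi hj).mp hp).2.2)
  rw [coeff_mul, card_eq_sum_card_fiberwise maps, Nat.cast_sum]
  refine Int.ModEq.sum fun x hx => ?_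
  rw [fiber x hx, card_product, Nat.cast_mul]
  exact (coeff_thetaTail_modEq i x.1).mul (coeff_thetaTail_modEq j x.2)

theorem sq_mod_four (a : ℕ) : a ^ 2 % 4 = a % 2 := by
  rw [Nat.pow_mod, ← Nat.mod_mod_of_dvd a (by decide : 2 ∣ 4)]
  have : a % 4 < 4 := Nat.mod_lt _ (by decide)
  interval_cases a % 4 <;> rfl

theorem even_and_even_of_add_eq_four_mul {i j n a b : ℕ} (hi : ¬ 4 ∣ i) (hj : ¬ 4 ∣ j)
    (hij : ¬ 4 ∣ i + j) (h : i * a ^ 2 + j * b ^ 2 = 4 * n) : Even a ∧ Even b := by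
  have h4 : (i * (a % 2) + j * (b % 2)) % 4 = 0 := by
    rw [← sq_mod_four, ← sq_mod_four, ← Nat.mul_mod_right 4 n, ← h]
    simp [Nat.add_mod, Nat.mul_mod]
  rw [Nat.even_iff, Nat.even_iff]
  rcases Nat.mod_two_eq_zero_or_one a with ha | ha <;>
    rcases Nat.mod_two_eq_zero_or_one b with hb | hb <;> rw [ha, hb] at h4 <;> lia

theorem card_filter_even_squarePairs {i j : ℕ} (hi : 0 < i) (hj : 0 < j) (n : ℕ) :
    #{p ∈ squarePairs i j (4 * n) | Even p.1 ∧ Even p.2} = #(squarePairs i j n) := by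
  have double_injective : Function.Injective (Prod.map (2 * ·) (2 * ·) : ℕ × ℕ → ℕ × ℕ) :=
    (mul_right_injective₀ two_ne_zero).prodMap (mul_right_injective₀ two_ne_zero)
  rw [← card_image_of_injective (squarePairs i j n) double_injective]
  congr 1
  ext ⟨a, b⟩
  simp only [mem_filter, mem_image, mem_squarePairs hi hj, Prod.map, Prod.exists, Prod.mk.injEq]
  constructor
  · rintro ⟨⟨ha, hb, h⟩, hae, hbe⟩
    obtain ⟨c, rfl⟩ := hae.two_dvd
    obtain ⟨d, rfl⟩ := hbe.two_dvd
    exact ⟨c, d, ⟨by lia, by lia, by linarith⟩, rfl, rfl⟩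
  · rintro ⟨c, d, ⟨hc, hd, h⟩, rfl, rfl⟩
    exact ⟨⟨by lia, by lia, by linarith⟩, even_two_mul c, even_two_mul d⟩

theorem card_squarePairs_four_mul {i j : ℕ} (hi : ¬ 4 ∣ i) (hj : ¬ 4 ∣ j) (hij : ¬ 4 ∣ i + j)
    (n : ℕ) : #(squarePairs i j (4 * n)) = #(squarePairs i j n) := by
  have hi' : 0 < i := by lia
  have hj' : 0 < j := by lia
  rw [← card_filter_even_squarePairs hi' hj' n, filter_true_of_mem fun p hp =>
    even_and_even_of_add_eq_four_mul hi hj hij ((mem_squarePairs hi' hj').mp hp).2.2]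

theorem coeff_four_mul_thetaTail_mul_thetaTail {i j : ℕ} (hi : ¬ 4 ∣ i) (hj : ¬ 4 ∣ j)
    (hij : ¬ 4 ∣ i + j) (n : ℕ) :
    coeff (4 * n) (thetaTail i * thetaTail j) ≡ coeff n (thetaTail i * thetaTail j) [ZMOD 2] := by
  have hi' : 0 < i := by lia
  have hj' : 0 < j := by lia
  refine (coeff_thetaTail_mul_thetaTail_modEq hi' hj' _).trans ?_
  rw [card_squarePairs_four_mul hi hj hij]
  exact (coeff_thetaTail_mul_thetaTail_modEq hi' hj' n).symm

end SquarePairs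

section EisensteinRotation

/-- The pairs of odd positive integers `(a, b)` with `a ^ 2 + 3 * b ^ 2 = n`. -/
def oddPairs (n : ℕ) : Finset (ℕ × ℕ) :=
  {p ∈ squarePairs 1 3 n | Odd p.1 ∧ Odd p.2}

theorem mem_oddPairs {n a b : ℕ} :
    (a, b) ∈ oddPairs n ↔ Odd a ∧ Odd b ∧ a ^ 2 + 3 * b ^ 2 = n := by
  rw [oddPairs, mem_filter, mem_squarePairs one_pos three_pos, one_mul]
  exact ⟨fun h => ⟨h.2.1, h.2.2, h.1.2.2⟩, fun ⟨ha, hb, h⟩ => ⟨⟨ha.pos, hb.pos, h⟩, ha, hb⟩⟩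

theorem card_squarePairs_one_three_four_mul (n : ℕ) :
    #(squarePairs 1 3 (4 * n)) = #(squarePairs 1 3 n) + #(oddPairs (4 * n)) := by
  rw [← card_filter_even_squarePairs one_pos three_pos n, oddPairs,
    ← card_filter_add_card_filter_not (s := squarePairs 1 3 (4 * n)) fun p => Even p.1 ∧ Even p.2]
  congr 2
  refine filter_congr fun p hp => ?_
  have h := ((mem_squarePairs one_pos three_pos).mp hp).2.2
  have := sq_mod_four p.1
  have := sq_mod_four p.2
  simp only [Nat.even_iff, Nat.odd_iff]
  lia

/-- Multiplication of `a + b √-3` by a primitive sixth root of unity, where the root and the signs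
of the resulting coordinates are chosen so as to preserve positivity and oddness. -/
def rotatePair (p : ℕ × ℕ) : ℕ × ℕ :=
  let s : ℤ := if p.1 % 4 = p.2 % 4 then p.2 else -p.2
  (((p.1 - 3 * s) / 2).natAbs, ((p.1 + s) / 2).natAbs)

theorem rotatePair_mem_oddPairs {n : ℕ} {p : ℕ × ℕ} (hp : p ∈ oddPairs n) :
    rotatePair p ∈ oddPairs n := by
  obtain ⟨a, b⟩ := p
  obtain ⟨ha, hb, h⟩ := mem_oddPairs.mp hp
  rw [Nat.odd_iff] at ha hb
  obtain ⟨s, hs, hs2, hmod⟩ : ∃ s : ℤ, s = (if a % 4 = b % 4 then (b : ℤ) else -b) ∧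
      s ^ 2 = (b : ℤ) ^ 2 ∧ (a - s) % 4 = 0 :=
    ⟨_, rfl, by split_ifs <;> ring, by lia⟩
  obtain ⟨k, hk⟩ := Int.dvd_of_emod_eq_zero hmod
  rw [rotatePair, ← hs, mem_oddPairs, Int.natAbs_odd, Int.natAbs_odd, Int.odd_iff, Int.odd_iff]
  refine ⟨by lia, by lia, ?_⟩
  zify at h ⊢
  rw [sq_abs, sq_abs, show (a - 3 * s) / 2 = 2 * k - s by lia, show (a + s) / 2 = 2 * k + s by lia]
  linear_combination h + 3 * hs2 - (a + s + 4 * k) * hk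

theorem rotatePair_rotatePair {n : ℕ} {p : ℕ × ℕ} (hp : p ∈ oddPairs n) :
    rotatePair (rotatePair p) = p := by
  obtain ⟨ha, hb, -⟩ := mem_oddPairs.mp hp
  rw [Nat.odd_iff] at ha hb
  simp only [rotatePair, Prod.ext_iff]
  lia

theorem rotatePair_eq_self_iff {n : ℕ} {p : ℕ × ℕ} (hp : p ∈ oddPairs n) :
    rotatePair p = p ↔ p.1 = p.2 ∨ p.1 = 3 * p.2 := by
  obtain ⟨ha, hb, -⟩ := mem_oddPairs.mp hp
  rw [Nat.odd_iff] at ha hb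
  simp only [rotatePair, Prod.ext_iff]
  lia

theorem card_modEq_card_filter_fixed {α : Type*} [DecidableEq α] {s : Finset α} {f : α → α}
    (maps : ∀ a ∈ s, f a ∈ s) (involutive : ∀ a ∈ s, f (f a) = a) :
    #s ≡ #{a ∈ s | f a = a} [MOD 2] := by
  have moved : ((#{a ∈ s | ¬ f a = a} : ℕ) : ZMod 2) = 0 := by
    rw [card_eq_sum_ones, Nat.cast_sum]
    refine sum_involution (fun a _ => f a) (fun _ _ => by decide)
      (fun a ha _ => (mem_filter.mp ha).2) (fun a ha => ?_)
      fun a ha => involutive a (mem_filter.mp ha).1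
    obtain ⟨has, hne⟩ := mem_filter.mp ha
    exact mem_filter.mpr ⟨maps a has, by rw [involutive a has]; exact Ne.symm hne⟩
  rw [← ZMod.natCast_eq_natCast_iff, ← card_filter_add_card_filter_not (s := s) fun a => f a = a,
    Nat.cast_add, moved, add_zero]

theorem card_oddPairs_four_mul (n : ℕ) :
    #(oddPairs (4 * n)) ≡ #{a ∈ sqRoots 1 n | Odd a} + #{a ∈ sqRoots 3 n | Odd a} [MOD 2] := by
  have diagonal : {p ∈ oddPairs (4 * n) | p.1 = p.2} =
      {a ∈ sqRoots 1 n | Odd a}.image fun a => (a, a) := by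
    ext ⟨a, b⟩
    simp only [mem_filter, mem_image, mem_oddPairs, mem_sqRoots one_pos, Prod.mk.injEq]
    constructor
    · rintro ⟨⟨ha, -, h⟩, rfl⟩
      exact ⟨a, ⟨⟨ha.pos, by linarith⟩, ha⟩, rfl, rfl⟩
    · rintro ⟨c, ⟨⟨-, h⟩, hc⟩, rfl, rfl⟩
      exact ⟨⟨hc, hc, by linarith⟩, rfl⟩
  have triple : {p ∈ oddPairs (4 * n) | p.1 = 3 * p.2} =
      {a ∈ sqRoots 3 n | Odd a}.image fun a => (3 * a, a) := by
    ext ⟨a, b⟩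
    simp only [mem_filter, mem_image, mem_oddPairs, mem_sqRoots three_pos, Prod.mk.injEq]
    constructor
    · rintro ⟨⟨-, hb, h⟩, rfl⟩
      exact ⟨b, ⟨⟨hb.pos, by linarith⟩, hb⟩, rfl, rfl⟩
    · rintro ⟨c, ⟨⟨-, h⟩, hc⟩, rfl, rfl⟩
      exact ⟨⟨Nat.odd_mul.mpr ⟨by decide, hc⟩, hc, by linarith⟩, rfl⟩
  have disjoint : Disjoint {p ∈ oddPairs (4 * n) | p.1 = p.2}
      {p ∈ oddPairs (4 * n) | p.1 = 3 * p.2} := by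
    refine disjoint_filter.mpr fun p hp h₁ h₃ => ?_
    have := (mem_oddPairs.mp hp).2.1.pos
    lia
  refine (card_modEq_card_filter_fixed (fun _ => rotatePair_mem_oddPairs)
    fun _ => rotatePair_rotatePair).trans ?_
  rw [filter_congr fun _ => rotatePair_eq_self_iff, filter_or, card_union_of_disjoint disjoint,
    diagonal, triple, card_image_of_injective _ fun _ _ h => congrArg Prod.snd h,
    card_image_of_injective _ fun _ _ h => congrArg Prod.snd h]

end EisensteinRotation

section ModEight

theorem coeff_theta_mul_theta (i j n : ℕ) :
    coeff n (theta i * theta j) = coeff n (1 : ℤ⟦X⟧) +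
      2 * (coeff n (thetaTail i) + coeff n (thetaTail j)) +
      4 * coeff n (thetaTail i * thetaTail j) := by
  have : theta i * theta j =
      1 + C 2 * (thetaTail i + thetaTail j) + C 4 * (thetaTail i * thetaTail j) := by
    simp only [theta, map_ofNat]
    ring
  rw [this, map_add, map_add, coeff_C_mul, coeff_C_mul, map_add]

theorem coeff_four_mul_theta_one_mul_theta_three (n : ℕ) :
    coeff (4 * n) (theta 1 * theta 3) ≡ coeff n (theta 1 * theta 3) [ZMOD 8] := by
  have pairs := coeff_thetaTail_mul_thetaTail_modEq one_pos three_pos n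
  have pairs_four := coeff_thetaTail_mul_thetaTail_modEq one_pos three_pos (4 * n)
  have odd_pairs := Int.natCast_modEq_iff.mpr (card_oddPairs_four_mul n)
  rw [card_squarePairs_one_three_four_mul] at pairs_four
  rw [coeff_theta_mul_theta, coeff_theta_mul_theta, coeff_mul_one four_ne_zero,
    coeff_four_mul_thetaTail (by decide), coeff_four_mul_thetaTail (by decide)]
  simp only [Int.ModEq, Nat.cast_add] at pairs pairs_four odd_pairs ⊢
  lia

theorem coeff_theta_one_mul_theta_three_of_mod_four {m : ℕ} (hm : m % 4 = 2) :
    coeff m (theta 1 * theta 3) ≡ 0 [ZMOD 8] := by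
  have ne (a b : ℕ) : a ^ 2 + 3 * b ^ 2 ≠ m := by
    have := sq_mod_four a
    have := sq_mod_four b
    lia
  have roots_one : sqRoots 1 m = ∅ := filter_eq_empty_iff.mpr fun a _ h => ne a 0 (by lia)
  have roots_three : sqRoots 3 m = ∅ := filter_eq_empty_iff.mpr fun b _ h => ne 0 b (by lia)
  have pairs : squarePairs 1 3 m = ∅ := filter_eq_empty_iff.mpr fun p _ h => ne p.1 p.2 (by lia)
  have h := coeff_thetaTail_mul_thetaTail_modEq one_pos three_pos m
  rw [pairs, card_empty, Nat.cast_zero] at h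
  rw [coeff_theta_mul_theta, coeff_thetaTail, coeff_thetaTail, roots_one, roots_three, sum_empty,
    coeff_one, if_neg (by lia)]
  simpa using h.mul_left' (c := 4)

theorem coeff_four_mul_theta_two_mul_theta_six (n : ℕ) :
    coeff (4 * n) (theta 2 * theta 6) ≡ coeff n (theta 2 * theta 6) [ZMOD 8] := by
  have expanded : theta 2 * theta 6 = expand 2 two_ne_zero (theta 1 * theta 3) := by
    rw [map_mul, expand_theta two_ne_zero one_pos, expand_theta two_ne_zero three_pos]
    rfl
  rw [expanded, show 4 * n = 2 * (2 * n) by ring, coeff_expand_mul]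
  rcases n.even_or_odd' with ⟨m, rfl | rfl⟩
  · rw [coeff_expand_mul, ← mul_assoc]
    exact coeff_four_mul_theta_one_mul_theta_three m
  · rw [coeff_expand_of_not_dvd _ _ _ (by lia)]
    exact coeff_theta_one_mul_theta_three_of_mod_four (by lia)

theorem coeff_four_mul_schurCorrection {n : ℕ} (hn : ∀ a, Odd a → 3 * a ^ 2 ≠ n) :
    coeff (4 * n) (schurCorrection 3) ≡ coeff n (schurCorrection 3) [ZMOD 2] := by
  have tail {d : ℕ} (hd : 0 < d) (h : ¬ 4 ∣ d) :=
    coeff_four_mul_thetaTail_modEq hd (two_dvd_of_mul_sq_eq_four_mul (n := n) h)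
  have tail_twelve : coeff (4 * n) (thetaTail 12) ≡ coeff n (thetaTail 12) [ZMOD 2] := by
    refine coeff_four_mul_thetaTail_modEq (by decide) fun a ha => even_iff_two_dvd.mp ?_
    exact Nat.not_odd_iff_even.mp fun hodd => hn a hodd (by lia)
  have prod {i j : ℕ} (hi : ¬ 4 ∣ i) (hj : ¬ 4 ∣ j) (hij : ¬ 4 ∣ i + j) :=
    coeff_four_mul_thetaTail_mul_thetaTail hi hj hij n
  simp only [schurCorrection, add_mul, mul_add, map_add]
  refine .add (.add (.add (.add ?_ ?_) ?_) tail_twelve) (.add (.add ?_ ?_) (.add ?_ ?_))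
  · exact tail (by decide) (by decide)
  · exact tail (by decide) (by decide)
  · exact tail (by decide) (by decide)
  all_goals exact prod (by decide) (by decide) (by decide)

theorem schurOverpartitionCount_modEq_eight {t : ℕ} (ht : Odd t) (n : ℕ) :
    (schurOverpartitionCount t n : ℤ) ≡ coeff n (theta 1 * theta t) +
      coeff n (theta 2 * theta (2 * t)) - coeff n (1 : ℤ⟦X⟧) +
      4 * coeff n (schurCorrection t) [ZMOD 8] := by
  obtain ⟨q, hq⟩ := exists_schurGenFun_eq ht
  have h : C 8 ∣ schurGenFun t -
      (theta 1 * theta t + theta 2 * theta (2 * t) - 1 + C 4 * schurCorrection t) :=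
    ⟨q, by rw [hq, map_ofNat, map_ofNat]; ring⟩
  rw [← coeff_schurGenFun, ← coeff_C_mul, ← map_add, ← map_sub, ← map_add]
  exact coeff_modEq h n

theorem schurOverpartitionCount_three_four_mul {n : ℕ} (hn : ∀ a, Odd a → 3 * a ^ 2 ≠ n) :
    schurOverpartitionCount 3 (4 * n) ≡ schurOverpartitionCount 3 n [MOD 8] := by
  have ht : Odd 3 := by decide
  refine Int.natCast_modEq_iff.mp ((schurOverpartitionCount_modEq_eight ht _).trans
    (Int.ModEq.trans ?_ (schurOverpartitionCount_modEq_eight ht n).symm))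
  rw [coeff_mul_one four_ne_zero]
  exact (((coeff_four_mul_theta_one_mul_theta_three n).add
    (coeff_four_mul_theta_two_mul_theta_six n)).sub_right _).add
    ((coeff_four_mul_schurCorrection hn).mul_left' (c := 4))

theorem schurOverpartitionCount_three_four_pow_mul {n : ℕ} (hn : ∀ a, Odd a → 3 * a ^ 2 ≠ n)
    (k : ℕ) : schurOverpartitionCount 3 (4 ^ k * n) ≡ schurOverpartitionCount 3 n [MOD 8] := by
  induction k with
  | zero => rw [pow_zero, one_mul]
  | succ k ih =>
    rw [pow_succ', mul_assoc]
    refine (schurOverpartitionCount_three_four_mul fun a ha h => ?_).trans ih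
    rcases k with - | k
    · exact hn a ha (by simpa using h)
    · have odd : Odd (3 * a ^ 2) := Nat.odd_mul.mpr ⟨by decide, ha.pow⟩
      rw [h, pow_succ', mul_assoc, Nat.odd_mul] at odd
      exact absurd odd.1 (by decide)

end ModEight

theorem theorem4p2_general :
    (∀ t n, Odd t → Squarefree t →
      schurOverpartitionCount t (t * n) ≡ schurOverpartitionCount t n [MOD 4]) ∧
    (∀ t α n, Odd t →
      schurOverpartitionCount t (2 ^ α * n) ≡ schurOverpartitionCount t n [MOD 4]) ∧
    (∀ n β, (∀ a, Odd a → 3 * a ^ 2 ≠ n) →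
      schurOverpartitionCount 3 (4 ^ β * n) ≡ schurOverpartitionCount 3 n [MOD 8]) :=
  ⟨fun _ n ht hsf => schurOverpartitionCount_self_mul ht hsf n,
    fun _ α n ht => schurOverpartitionCount_two_pow_mul ht α n,
    fun _ β hn => schurOverpartitionCount_three_four_pow_mul hn β⟩

theorem theorem4p2 :
    (∀ n : ℕ,
      schurOverpartitionCount 3 (3 * n) ≡ schurOverpartitionCount 3 n [MOD 4]) ∧
    (∀ n α j : ℕ, j ∈ ({0, 1, 2} : Finset ℕ) →
      schurOverpartitionCount 3 (2 ^ α * (3 * n + j)) ≡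
        schurOverpartitionCount 3 (3 * n + j) [MOD 4]) ∧
    (∀ n β j : ℕ, 1 ≤ β → j ∈ ({0, 1} : Finset ℕ) →
      schurOverpartitionCount 3 (2 ^ (2 * β + j) * (3 * n + 2)) ≡
        schurOverpartitionCount 3 (2 ^ j * (3 * n + 2)) [MOD 8]) := by
  obtain ⟨self_mul, two_pow_mul, four_pow_mul⟩ := theorem4p2_general
  refine ⟨fun n => self_mul 3 n (by decide) Nat.prime_three.squarefree,
    fun n α j _ => two_pow_mul 3 α _ (by decide), fun n β j _ hj => ?_⟩
  rw [pow_add, pow_mul, mul_assoc]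
  refine four_pow_mul _ β fun a _ h => ?_
  rw [mem_insert, mem_singleton] at hj
  rcases hj with rfl | rfl <;> lia
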